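/- A modulus of continuity is a continuous nondecreasing function $\rho:[0,1]\to[0,\infty)$ with $\rho(0)=0$ and $\rho(h)>0$ for $h\in(0,1]$. For $f\in C[0,1]$ let $|f|_\rho=\sup_{u\neq v}\frac{|f(u)-f(v)|}{\rho(|u-v|)}\in[0,\infty]$, the supremum being over $u,v\in[0,1]$. For two moduli of continuity write $\rho\gg\rho^*$ if $\rho^*(h)/\rho(h)\to 0$ as $h\downarrow 0$. Let $W_n$ ($n\in\mathbb{N}$) and $W$ be random elements of $C[0,1]$, each possibly defined on its own probability space, and let $\rho^*$ be a modulus of continuity such that $|W_n|_{\rho^*}<\infty$ almost surely for every $n$ and $|W|_{\rho^*}<\infty$ almost surely. Suppose that (i) the finite dimensional marginals of $W_n$ converge weakly to those of $W$, i.e. $(W_n(t_1),\dots,W_n(t_k))\Rightarrow (W(t_1),\dots,W(t_k))$ for all $k$ and $t_1,\dots,t_k\in[0,1]$; (ii) $|W_n|_{\rho^*}$ converges weakly to $|W|_{\rho^*}$ beyond some threshold $T\in\mathbb{R}$, i.e. $P(|W_n|_{\rho^*}>t)\to P(|W|_{\rho^*}>t)$ for every $t>T$ at which the distribution function of $|W|_{\rho^*}$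 is continuous. Then there exist a single probability space and random elements $\widetilde W_n$ ($n\in\mathbb{N}$), $\widetilde W$ of $C[0,1]$ defined on it such that $\widetilde W_n$ has the same law as $W_n$ for every $n$, $\widetilde W$ has the same law as $W$, and, simultaneously for every modulus of continuity $\rho\gg\rho^*$, $$|\widetilde W_n-\widetilde W|_{\rho}\to 0\quad\text{in probability as } n\to\infty .$$ -/

import Mathlib

open MeasureTheory ProbabilityTheory Filter Topology
open scoped ENNReal unitInterval

/-- A modulus of continuity on `[0,1]`: a continuous, nondecreasing function that vanishes at `0`
and is positive on `(0,1]`. Only the values on `[0,1]` matter. -/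
structure IsModulus (ρ : ℝ → ℝ) : Prop where
  continuousOn : ContinuousOn ρ (Set.Icc 0 1)
  monotoneOn : MonotoneOn ρ (Set.Icc 0 1)
  map_zero : ρ 0 = 0
  pos : ∀ h ∈ Set.Ioc (0 : ℝ) 1, 0 < ρ h

/-- `MuchLarger ρ ρ'` is the relation `ρ ≫ ρ'`: the quotient `ρ'(h) / ρ(h)` tends to `0` as
`h ↓ 0`. -/
def MuchLarger (ρ ρ' : ℝ → ℝ) : Prop :=
  Tendsto (fun h : ℝ => ρ' h / ρ h) (𝓝[>] 0) (𝓝 0)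

/-- The Hölder-type seminorm `|f|_ρ = sup_{u ≠ v} |f u - f v| / ρ |u - v|`, with values
in `[0, ∞]`. -/
noncomputable def holderSeminorm (ρ : ℝ → ℝ) (f : C(I, ℝ)) : ℝ≥0∞ :=
  ⨆ (u : I) (v : I) (_ : u ≠ v), ENNReal.ofReal (|f u - f v| / ρ |(u : ℝ) - (v : ℝ)|)

/-- Weak convergence of the finite dimensional marginals: for finitely many points
`t 1, …, t k` of `[0,1]`, the random vectors `(W n (t 1), …, W n (t k))` converge in distribution
to `(Z (t 1), …, Z (t k))`. Every process may live on its own probability space. -/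
def TendstoFidi {Ω : ℕ → Type*} {Ω' : Type*} [∀ n, MeasurableSpace (Ω n)] [MeasurableSpace Ω']
    (μ : ∀ n, Measure (Ω n)) [∀ n, IsProbabilityMeasure (μ n)]
    (ν : Measure Ω') [IsProbabilityMeasure ν]
    (W : ∀ n, Ω n → C(I, ℝ)) (Z : Ω' → C(I, ℝ)) : Prop :=
  ∀ (k : ℕ) (t : Fin k → I),
    TendstoInDistribution (fun n ω => fun i : Fin k => W n ω (t i)) atTop
      (fun ω => fun i : Fin k => Z ω (t i)) μ ν

/-- Weak convergence beyond the threshold `τ` of real random variables `X n` to `Y`: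
`P(X n > t) → P(Y > t)` for all `t > τ` at which the distribution function of `Y` is
continuous. -/
def TendstoBeyond (τ : ℝ) {Ω : ℕ → Type*} {Ω' : Type*} [∀ n, MeasurableSpace (Ω n)]
    [MeasurableSpace Ω'] (μ : ∀ n, Measure (Ω n)) (ν : Measure Ω')
    (X : ∀ n, Ω n → ℝ) (Y : Ω' → ℝ) : Prop :=
  ∀ t : ℝ, τ < t → ContinuousAt (fun s : ℝ => ν.real {ω | Y ω ≤ s}) t →
    Tendsto (fun n => (μ n).real {ω | t < X n ω}) atTop (𝓝 (ν.real {ω | t < Y ω}))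

/-! No limit theorem in `C(I, ℝ)` itself is needed. Evaluation on a grid maps the laws to a finite
dimensional space, where weak convergence holds by (i). Cut that space into finitely many small
cells with null frontiers, plus a rare leftover cell. For large `n` every cell keeps at least `1 -
ε` of its limit mass, so the `n`-th law is a mixture, weighted by the limit law `Q`, of measures
that nearly sit on the cells (`exists_mixture`). Drawing a `Q`-point, then a point from the measure
of its cell, makes the two agree on the grid up to the cell diameter. Letting the grid refine
slowly, `k = κ n → ∞`, and using one product space for all `n` gives the coupling
(`exists_realization_dist_small`), which involves no modulus.

By (ii) both `ρ*`-seminorms are at most some `K` with high probability. The difference then has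
`ρ*`-seminorm at most `2K` and is small on a fine grid, hence uniformly small. Close pairs are
controlled by `ρ*/ρ → 0`, distant ones by the uniform bound
(`eventually_holderSeminorm_le_of_unitGrid`). -/

/-! ### Cells, mixtures and the product space -/

/-- A separable pseudometric space splits, up to a set of small measure, into finitely many cells
of small diameter whose frontiers are null; `c` labels the cells and `m` is the exceptional
label. -/
theorem exists_label_null_frontier {F : Type*} [PseudoMetricSpace F]
    [TopologicalSpace.SeparableSpace F] [MeasurableSpace F] [OpensMeasurableSpace F]
    (Q : Measure F) [IsProbabilityMeasure Q] {δ : ℝ} (hδ : 0 < δ) {ε : ℝ≥0∞} (hε : 0 < ε) :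
    ∃ (m : ℕ) (c : F → ℕ), Measurable c ∧ (∀ x, c x ≤ m) ∧
      (∀ x y, c x = c y → c x ≠ m → dist x y ≤ δ) ∧ Q (c ⁻¹' {m}) < ε ∧
      ∀ j, Q (frontier (c ⁻¹' {j})) = 0 := by
  classical
  have : Nonempty F := nonempty_of_isProbabilityMeasure Q
  let x : ℕ → F := TopologicalSpace.denseSeq F
  -- Radii above `δ / 4` make balls about a dense sequence cover; radii below `δ / 2` keep diameters
  -- within `δ`.
  have hr : ∀ i, ∃ r ∈ Set.Ioo (δ / 4) (δ / 2), Q (frontier (Metric.ball (x i) r)) = 0 := by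
    intro i
    obtain ⟨r, hr, h0⟩ := exists_null_frontier_thickening Q {x i} (a := δ / 4) (b := δ / 2)
      (by linarith)
    exact ⟨r, hr, by rwa [Metric.thickening_singleton] at h0⟩
  choose r hr h0 using hr
  let B : ℕ → Set F := fun i => Metric.ball (x i) (r i)
  have hcover : ∀ y, ∃ i, y ∈ B i := by
    intro y
    obtain ⟨i, hi⟩ := (TopologicalSpace.denseRange_denseSeq F).exists_dist_lt y
      (show 0 < δ / 4 by linarith)
    exact ⟨i, by simpa [B] using hi.trans (hr i).1⟩
  let f : F → ℕ := fun y => Nat.find (hcover y)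
  have hfm : Measurable f := measurable_find hcover fun i => Metric.isOpen_ball.measurableSet
  have htend : Tendsto (fun m => Q (f ⁻¹' Set.Ici m)) atTop (𝓝 0) := by
    have h := tendsto_measure_iInter_atTop (μ := Q) (s := fun m => f ⁻¹' Set.Ici m)
      (fun m => (hfm measurableSet_Ici).nullMeasurableSet)
      (fun a b hab => Set.preimage_mono (Set.Ici_subset_Ici.2 hab)) ⟨0, measure_ne_top _ _⟩
    have he : (⋂ m, f ⁻¹' Set.Ici m) = ∅ := by
      refine Set.eq_empty_iff_forall_notMem.2 fun y hy => ?_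
      have := Set.mem_iInter.1 hy (f y + 1)
      simp at this
    rwa [he, measure_empty] at h
  obtain ⟨m, hm⟩ := (htend.eventually (gt_mem_nhds hε)).exists
  -- The label is the index of the first ball containing the point, truncated at `m`.
  refine ⟨m, fun y => min (f y) m, hfm.min measurable_const, fun y => min_le_right _ _, ?_, ?_, ?_⟩
  · intro y z hyz hy
    have h1 : f y < m := by
      by_contra h; exact hy (min_eq_right (not_lt.1 h))
    have h2 : f z = f y := by
      have : min (f y) m = f y := min_eq_left h1.le
      simp only [this] at hyz
      omega
    have h3 : y ∈ B (f y) := Nat.find_spec (hcover y)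
    have h4 : z ∈ B (f y) := h2 ▸ Nat.find_spec (hcover z)
    have := (hr (f y)).2
    simp only [B, Metric.mem_ball] at h3 h4
    linarith [dist_triangle_right y z (x (f y))]
  · convert hm using 2
    ext y
    simp
  · intro j
    -- Off all the ball frontiers, membership in the first `f y + 1` balls is locally constant,
    -- hence so is the label.
    have hsub : frontier ((fun y => min (f y) m) ⁻¹' {j}) ⊆ ⋃ i, frontier (B i) := by
      intro y hy
      by_contra hn
      have hev : ∀ i, ∀ᶠ z in 𝓝 y, (z ∈ B i ↔ y ∈ B i) := by
        intro i
        have hyi : y ∉ frontier (B i) := fun h => hn (Set.mem_iUnion.2 ⟨i, h⟩)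
        by_cases hB : y ∈ B i
        · filter_upwards [Metric.isOpen_ball.mem_nhds hB] with z hz using iff_of_true hz hB
        · have : y ∈ (closure (B i))ᶜ := fun h =>
            hyi ⟨h, fun h' => hB (interior_subset h')⟩
          filter_upwards [isClosed_closure.isOpen_compl.mem_nhds this] with z hz
          exact iff_of_false (fun h => hz (subset_closure h)) hB
      have hfin : ∀ᶠ z in 𝓝 y, f z = f y := by
        have : ∀ᶠ z in 𝓝 y, ∀ i ∈ Finset.range (f y + 1), (z ∈ B i ↔ y ∈ B i) :=
          (Finset.eventually_all _).2 fun i _ => hev i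
        filter_upwards [this] with z hz
        refine (Nat.find_eq_iff (hcover z)).2 ⟨?_, fun n hn => ?_⟩
        · exact (hz _ (by simp)).2 (Nat.find_spec (hcover y))
        · exact fun h => Nat.find_min (hcover y) hn
            ((hz n (by simp only [Finset.mem_range]; omega)).1 h)
      by_cases hj : min (f y) m = j
      · refine hy.2 (mem_interior_iff_mem_nhds.2 ?_)
        filter_upwards [hfin] with z hz
        simp [hz, hj]
      · have := mem_closure_iff_frequently.1 hy.1
        refine this ?_
        filter_upwards [hfin] with z hz
        simp [hz, hj]
    refine measure_mono_null hsub (measure_iUnion_null h0)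

/-- The labels of `exists_label_null_frontier`, pulled back along `g`: weak convergence of the laws
of `g` makes the cell probabilities of the approximating measures eventually almost as large as
those of the limit. -/
theorem exists_label_eventually_le {E F : Type*} [MeasurableSpace E] [PseudoMetricSpace F]
    [TopologicalSpace.SeparableSpace F] [MeasurableSpace F] [OpensMeasurableSpace F]
    {g : E → F} (hg : Measurable g) (P : ℕ → ProbabilityMeasure E) (Q : ProbabilityMeasure E)
    (h : Tendsto (fun n => (P n).map hg.aemeasurable) atTop (𝓝 (Q.map hg.aemeasurable)))
    {δ : ℝ} (hδ : 0 < δ) {ε : ℝ≥0∞} (hε : 0 < ε) :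
    ∃ (m : ℕ) (c : E → ℕ), Measurable c ∧
      (∀ x y, c x = c y → c x ≠ m → dist (g x) (g y) ≤ δ) ∧ (Q : Measure E) (c ⁻¹' {m}) ≤ ε ∧
      ∀ᶠ n in atTop, ∀ j, (1 - ε) * (Q : Measure E) (c ⁻¹' {j}) ≤ (P n : Measure E) (c ⁻¹' {j}) := by
  obtain ⟨m, c, hc, hcm, hd, hQ, hfr⟩ :=
    exists_label_null_frontier (Q.map hg.aemeasurable : Measure F) hδ hε
  have hmap : ∀ (R : ProbabilityMeasure E) j,
      (R.map hg.aemeasurable : Measure F) (c ⁻¹' {j}) = (R : Measure E) ((c ∘ g) ⁻¹' {j}) :=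
    fun R j => by
      rw [ProbabilityMeasure.toMeasure_map, Measure.map_apply hg (hc (measurableSet_singleton j))]
      rfl
  refine ⟨m, c ∘ g, hc.comp hg, fun x y => hd _ _, (hmap Q m) ▸ hQ.le, ?_⟩
  have hev : ∀ j, ∀ᶠ n in atTop,
      (1 - ε) * (Q : Measure E) ((c ∘ g) ⁻¹' {j}) ≤ (P n : Measure E) ((c ∘ g) ⁻¹' {j}) := by
    intro j
    have ht := ProbabilityMeasure.tendsto_measure_of_null_frontier_of_tendsto' h (hfr j)
    simp only [hmap] at ht
    rcases eq_or_ne ((Q : Measure E) ((c ∘ g) ⁻¹' {j})) 0 with h0 | h0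
    · simp [h0]
    · refine (ht.eventually (lt_mem_nhds (a := (1 - ε) * _) ?_)).mono fun n hn => hn.le
      calc _ < 1 * (Q : Measure E) ((c ∘ g) ⁻¹' {j}) :=
            (ENNReal.mul_lt_mul_iff_left h0 (measure_ne_top _ _)).2
              (ENNReal.sub_lt_self ENNReal.one_ne_top one_ne_zero hε.ne')
        _ = _ := one_mul _
  have hall : ∀ᶠ n in atTop, ∀ j ∈ Finset.range (m + 1),
      (1 - ε) * (Q : Measure E) ((c ∘ g) ⁻¹' {j}) ≤ (P n : Measure E) ((c ∘ g) ⁻¹' {j}) :=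
    (Finset.eventually_all _).2 fun j _ => hev j
  filter_upwards [hall] with n hn j
  by_cases hj : j ≤ m
  · exact hn j (by simp only [Finset.mem_range]; omega)
  · have : (c ∘ g) ⁻¹' {j} = ∅ := by
      refine Set.eq_empty_iff_forall_notMem.2 fun y hy => hj ?_
      have : c (g y) = j := hy
      exact this ▸ hcm (g y)
    simp [this]

/-- Integrating a function of a discrete label. -/
theorem lintegral_comp_label {E : Type*} [MeasurableSpace E] (Q : Measure E)
    {c : E → ℕ} (hc : Measurable c) (f : ℕ → ℝ≥0∞) :
    ∫⁻ z, f (c z) ∂Q = ∑' j, f j * Q (c ⁻¹' {j}) := by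
  rw [← lintegral_map (f := f) (by fun_prop) hc, lintegral_countable']
  exact tsum_congr fun j => by rw [Measure.map_apply hc (measurableSet_singleton j)]

/-- If `P` gives every cell at least `t` times its `Q`-measure, then `P` is a `Q`-mixture of
probability measures, the one attached to a cell giving that cell mass at least `t`. -/
theorem exists_mixture {E : Type*} [MeasurableSpace E] (P Q : Measure E)
    [IsProbabilityMeasure P] [IsProbabilityMeasure Q] {c : E → ℕ} (hc : Measurable c)
    {t : ℝ≥0∞} (ht : t ≤ 1) (h : ∀ j, t * Q (c ⁻¹' {j}) ≤ P (c ⁻¹' {j})) :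
    ∃ ν : ℕ → Measure E, (∀ j, IsProbabilityMeasure (ν j)) ∧
      (∀ A, MeasurableSet A → ∫⁻ z, ν (c z) A ∂Q = P A) ∧
      ∀ j, Q (c ⁻¹' {j}) ≠ 0 → ν j (c ⁻¹' {j})ᶜ ≤ 1 - t := by
  classical
  have ht' : t ≠ ∞ := ne_top_of_le_ne_top ENNReal.one_ne_top ht
  have hms : ∀ j, MeasurableSet (c ⁻¹' {j}) := fun j => hc (measurableSet_singleton j)
  choose a ha using fun j => exists_add_of_le (h j)
  -- On a `P`-null cell the choice is immaterial, since `κ j` enters the mixture with total weight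
  -- `P (c ⁻¹' {j}) = 0`.
  let κ : ℕ → Measure E := fun j => if P (c ⁻¹' {j}) = 0 then P else P[|c ⁻¹' {j}]
  have hκp : ∀ j, IsProbabilityMeasure (κ j) := by
    intro j
    by_cases hj : P (c ⁻¹' {j}) = 0
    · simp only [κ, if_pos hj]; infer_instance
    · simp only [κ, if_neg hj]; exact cond_isProbabilityMeasure hj
  have hκ : ∀ j A, MeasurableSet A → P (c ⁻¹' {j}) * κ j A = P (c ⁻¹' {j} ∩ A) := by
    intro j A hA
    by_cases hj : P (c ⁻¹' {j}) = 0
    · rw [hj, zero_mul, measure_mono_null Set.inter_subset_left hj]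
    · simp only [κ, if_neg hj]
      rw [cond_apply (hms j), ← mul_assoc, ENNReal.mul_inv_cancel hj (measure_ne_top _ _), one_mul]
  have hsum : ∀ (R : Measure E) A, MeasurableSet A → ∑' j, R (c ⁻¹' {j} ∩ A) = R A := by
    intro R A hA
    rw [← measure_iUnion]
    · congr 1; ext y; simp
    · intro i j hij
      refine Set.disjoint_left.2 fun y hy hy' => hij ?_
      have h1 : c y = i := hy.1
      have h2 : c y = j := hy'.1
      exact h1.symm.trans h2
    · exact fun j => (hms j).inter hA
  have hsum1 : ∀ (R : Measure E) [IsProbabilityMeasure R], ∑' j, R (c ⁻¹' {j}) = 1 := by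
    intro R _
    simpa using hsum R Set.univ MeasurableSet.univ
  have hat : t + ∑' j, a j = 1 := by
    rw [← hsum1 P, tsum_congr ha, ENNReal.tsum_add, ENNReal.tsum_mul_left, hsum1 Q, mul_one]
  have hat' : ∑' j, a j = 1 - t := ENNReal.eq_sub_of_add_eq ht' (by rw [add_comm]; exact hat)
  -- The surplus of all cells, pooled into one measure of mass `1 - t` shared by every label.
  let R : Measure E := Measure.sum fun j => a j • κ j
  have hR : ∀ A, MeasurableSet A → R A = ∑' j, a j * κ j A := fun A hA => by
    simp [R, Measure.sum_apply _ hA]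
  have hRu : R Set.univ = 1 - t := by
    rw [hR _ MeasurableSet.univ, ← hat']
    simp
  refine ⟨fun j => t • κ j + R, fun j => ⟨?_⟩, fun A hA => ?_, fun j hj => ?_⟩
  · simp [hRu, add_tsub_cancel_of_le ht]
  · rw [lintegral_comp_label Q hc fun j => (t • κ j + R) A, ← hsum P A hA]
    simp only [Measure.coe_add, Measure.coe_smul, Pi.add_apply, Pi.smul_apply, smul_eq_mul, add_mul]
    rw [ENNReal.tsum_add, ENNReal.tsum_mul_left, hsum1 Q, mul_one, hR A hA, ← ENNReal.tsum_add]
    refine tsum_congr fun j => ?_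
    rw [← hκ j A hA, ha j]
    ring
  · have h0 : t * κ j (c ⁻¹' {j})ᶜ = 0 := by
      by_cases hP : P (c ⁻¹' {j}) = 0
      · have := h j
        rw [hP, nonpos_iff_eq_zero, mul_eq_zero] at this
        rw [this.resolve_right hj, zero_mul]
      · simp only [κ, if_neg hP]
        rw [cond_apply (hms j)]
        simp
    calc (t • κ j + R) (c ⁻¹' {j})ᶜ = R (c ⁻¹' {j})ᶜ := by simp [h0]
      _ ≤ R Set.univ := measure_mono (Set.subset_univ _)
      _ = 1 - t := hRu

/-- The space on which the variables are realised: a `Q`-distributed point together with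
independent points of law `ν n j`. The `n`-th variable is the point whose index `j` is the label of
the `Q`-distributed one. -/
theorem prod_infinitePi_apply {E : Type*} [MeasurableSpace E] (Q : Measure E)
    [IsProbabilityMeasure Q] (ν : ℕ × ℕ → Measure E) [∀ p, IsProbabilityMeasure (ν p)]
    (n : ℕ) {c : E → ℕ} (hc : Measurable c) :
    Measurable (fun s : E × (ℕ × ℕ → E) => s.2 (n, c s.1)) ∧
    ∀ A : Set (E × E), MeasurableSet A →
      (Q.prod (Measure.infinitePi ν)) {s | (s.1, s.2 (n, c s.1)) ∈ A}
        = ∫⁻ z, ν (n, c z) {w | (z, w) ∈ A} ∂Q := by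
  have hm : Measurable (fun s : E × (ℕ × ℕ → E) => s.2 (n, c s.1)) := by
    have h : Measurable (fun q : ℕ × (ℕ × ℕ → E) => q.2 (n, q.1)) :=
      measurable_from_prod_countable_right fun j => measurable_pi_apply (n, j)
    exact h.comp ((hc.comp measurable_fst).prodMk measurable_snd)
  refine ⟨hm, fun A hA => ?_⟩
  refine (Measure.prod_apply ((measurable_fst.prodMk hm) hA)).trans ?_
  refine lintegral_congr fun z => ?_
  rw [← Measure.infinitePi_map_eval ν (n, c z),
    Measure.map_apply (measurable_pi_apply _)
      (show MeasurableSet {w | (z, w) ∈ A} from measurable_prodMk_left hA)]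
  rfl

/-! ### Seminorms and grids -/

/-- A supremum of continuous functions is lower semicontinuous; this supplies measurability of the
seminorm. -/
theorem isOpen_lt_holderSeminorm (ρ : ℝ → ℝ) (K : ℝ≥0∞) :
    IsOpen {f : C(I, ℝ) | K < holderSeminorm ρ f} := by
  have : LowerSemicontinuous (holderSeminorm ρ) := by
    refine lowerSemicontinuous_iSup fun u => lowerSemicontinuous_iSup fun v =>
      lowerSemicontinuous_iSup fun _ => Continuous.lowerSemicontinuous ?_
    exact ENNReal.continuous_ofReal.comp ((((continuous_eval_const u).sub
      (continuous_eval_const v)).abs).div_const _)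
  exact this.isOpen_preimage K

theorem unitInterval_abs_sub_mem_Ioc {u v : I} (h : u ≠ v) :
    |(u : ℝ) - v| ∈ Set.Ioc (0 : ℝ) 1 := by
  refine ⟨abs_pos.2 (sub_ne_zero.2 fun h' => h (Subtype.ext h')), ?_⟩
  rw [abs_le]
  constructor <;> linarith [u.2.1, u.2.2, v.2.1, v.2.2]

theorem holderSeminorm_le_ofReal_iff {ρ : ℝ → ℝ} (hρ : IsModulus ρ) {K : ℝ} (hK : 0 ≤ K)
    (f : C(I, ℝ)) :
    holderSeminorm ρ f ≤ ENNReal.ofReal K ↔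
      ∀ u v : I, |f u - f v| ≤ K * ρ |(u : ℝ) - v| := by
  simp only [holderSeminorm, iSup_le_iff]
  refine forall_congr' fun u => forall_congr' fun v => ?_
  by_cases h : u = v
  · simp [h, hρ.map_zero]
  · simp only [ne_eq, h, not_false_eq_true, forall_const]
    rw [ENNReal.ofReal_le_ofReal_iff hK,
      div_le_iff₀ (hρ.pos _ (unitInterval_abs_sub_mem_Ioc h))]

/-- The uniform grid of mesh `1 / (k + 1)` on the unit interval. -/
noncomputable def unitGrid (k : ℕ) (i : Fin (k + 2)) : I :=
  ⟨(i : ℝ) / (k + 1), by positivity, by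
    rw [div_le_one (by positivity)]
    have : (i : ℕ) ≤ k + 1 := by omega
    exact_mod_cast this⟩

theorem exists_unitGrid_near (k : ℕ) (u : I) :
    ∃ i, |(u : ℝ) - unitGrid k i| ≤ 1 / ((k : ℝ) + 1) := by
  have hk : (0 : ℝ) < k + 1 := by positivity
  have h0 : 0 ≤ (u : ℝ) * (k + 1) := mul_nonneg u.2.1 hk.le
  have hle : ⌊(u : ℝ) * (k + 1)⌋₊ ≤ k + 1 := by
    refine Nat.floor_le_of_le ?_
    push_cast
    nlinarith [u.2.2]
  refine ⟨⟨⌊(u : ℝ) * (k + 1)⌋₊, by omega⟩, ?_⟩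
  have h1 := Nat.floor_le h0
  have h2 := Nat.lt_floor_add_one ((u : ℝ) * (k + 1))
  have he : (u : ℝ) - (unitGrid k ⟨⌊(u : ℝ) * (k + 1)⌋₊, by omega⟩ : I)
      = ((u : ℝ) * (k + 1) - ⌊(u : ℝ) * (k + 1)⌋₊) / (k + 1) := by
    simp only [unitGrid]
    field_simp
  rw [he, abs_of_nonneg (div_nonneg (by linarith) hk.le)]
  gcongr
  linarith

/-- A function that is bounded in the stronger seminorm and small on a fine grid is small in the
weaker seminorm. -/
theorem eventually_holderSeminorm_le_of_unitGrid {ρ ρs : ℝ → ℝ} (hρ : IsModulus ρ)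
    (hρs : IsModulus ρs) (h : MuchLarger ρ ρs) {K : ℝ} (hK : 0 ≤ K) {ε : ℝ} (hε : 0 < ε) :
    ∀ᶠ k : ℕ in atTop, ∀ f : C(I, ℝ), holderSeminorm ρs f ≤ ENNReal.ofReal K →
      (∀ i, |f (unitGrid k i)| ≤ 1 / ((k : ℝ) + 1)) → holderSeminorm ρ f ≤ ENNReal.ofReal ε := by
  -- Dividing by `K + 1` instead of `K` covers `K = 0`.
  have h1 : ∀ᶠ x in 𝓝[>] (0 : ℝ), ρs x / ρ x < ε / (K + 1) :=
    Tendsto.eventually h (gt_mem_nhds (by positivity))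
  obtain ⟨δ, hδ, hδ'⟩ := mem_nhdsGT_iff_exists_Ioo_subset.1 h1
  rw [Set.mem_Ioi] at hδ
  set d := min (δ / 2) 1 with hd
  have hd0 : 0 < d := by positivity
  have hd1 : d ≤ 1 := min_le_right _ _
  have hdδ : d < δ := (min_le_left _ _).trans_lt (by linarith)
  have hρd : 0 < ρ d := hρ.pos d ⟨hd0, hd1⟩
  have hinv : Tendsto (fun k : ℕ => 1 / ((k : ℝ) + 1)) atTop (𝓝 0) :=
    tendsto_one_div_add_atTop_nhds_zero_nat
  have hmem : ∀ k : ℕ, 1 / ((k : ℝ) + 1) ∈ Set.Icc (0 : ℝ) 1 := fun k =>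
    ⟨by positivity, by rw [div_le_one (by positivity)]; linarith [Nat.cast_nonneg (α := ℝ) k]⟩
  have hmod : Tendsto (fun k : ℕ => ρs (1 / ((k : ℝ) + 1))) atTop (𝓝 0) := by
    have := (hρs.continuousOn 0 ⟨le_rfl, zero_le_one⟩).tendsto
    rw [hρs.map_zero] at this
    exact this.comp (tendsto_nhdsWithin_iff.2 ⟨hinv, Eventually.of_forall hmem⟩)
  have hlim : Tendsto (fun k : ℕ => 2 * (1 / ((k : ℝ) + 1) + K * ρs (1 / ((k : ℝ) + 1))))
      atTop (𝓝 0) := by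
    simpa using (hinv.add (hmod.const_mul K)).const_mul 2
  filter_upwards [hlim.eventually (gt_mem_nhds (show 0 < ε * ρ d by positivity))]
    with k hk f hf hgrid
  rw [holderSeminorm_le_ofReal_iff hρs hK] at hf
  rw [holderSeminorm_le_ofReal_iff hρ hε.le]
  have hsup : ∀ u, |f u| ≤ 1 / ((k : ℝ) + 1) + K * ρs (1 / ((k : ℝ) + 1)) := by
    intro u
    obtain ⟨i, hi⟩ := exists_unitGrid_near k u
    have h2 := hρs.monotoneOn ⟨abs_nonneg _, hi.trans (hmem k).2⟩ (hmem k) hi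
    have h3 := (hf u (unitGrid k i)).trans (mul_le_mul_of_nonneg_left h2 hK)
    have h4 := abs_sub_abs_le_abs_sub (f u) (f (unitGrid k i))
    linarith [hgrid i]
  intro u v
  by_cases huv : u = v
  · simp [huv, hρ.map_zero]
  have hmuv := unitInterval_abs_sub_mem_Ioc huv
  rcases lt_or_ge |(u : ℝ) - v| d with hlt | hge
  · have h2 : ρs |(u : ℝ) - v| / ρ |(u : ℝ) - v| < ε / (K + 1) := hδ' ⟨hmuv.1, hlt.trans hdδ⟩
    rw [div_lt_iff₀ (hρ.pos _ hmuv)] at h2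
    have hp := hρ.pos _ hmuv
    have hKε : K * (ε / (K + 1)) ≤ ε := by
      rw [← mul_div_assoc, div_le_iff₀ (by positivity)]; nlinarith
    calc |f u - f v| ≤ K * ρs |(u : ℝ) - v| := hf u v
      _ ≤ K * (ε / (K + 1) * ρ |(u : ℝ) - v|) := by gcongr
      _ = K * (ε / (K + 1)) * ρ |(u : ℝ) - v| := by ring
      _ ≤ ε * ρ |(u : ℝ) - v| := by gcongr
  · have h2 : ρ d ≤ ρ |(u : ℝ) - v| :=
      hρ.monotoneOn ⟨hd0.le, hd1⟩ ⟨hmuv.1.le, hmuv.2⟩ hge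
    have h3 : ε * ρ d ≤ ε * ρ |(u : ℝ) - v| := by gcongr
    linarith [abs_sub (f u) (f v), hsup u, hsup v]

theorem holderSeminorm_sub_le {ρ : ℝ → ℝ} (hρ : IsModulus ρ) {K : ℝ} (hK : 0 ≤ K)
    {f g : C(I, ℝ)} (hf : holderSeminorm ρ f ≤ ENNReal.ofReal K)
    (hg : holderSeminorm ρ g ≤ ENNReal.ofReal K) :
    holderSeminorm ρ (f - g) ≤ ENNReal.ofReal (2 * K) := by
  rw [holderSeminorm_le_ofReal_iff hρ hK] at hf hg
  rw [holderSeminorm_le_ofReal_iff hρ (by positivity)]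
  intro u v
  have h : (f - g) u - (f - g) v = (f u - f v) - (g u - g v) := by
    simp only [ContinuousMap.sub_apply]; ring
  rw [h]
  linarith [abs_sub (f u - f v) (g u - g v), hf u v, hg u v]

/-! ### Tightness -/

/-- Convergence beyond a threshold gives tightness. -/
theorem TendstoBeyond.exists_eventually_measure_lt {Ω : ℕ → Type*} {Ω' : Type*}
    [∀ n, MeasurableSpace (Ω n)] [MeasurableSpace Ω'] {μ : ∀ n, Measure (Ω n)}
    [∀ n, IsProbabilityMeasure (μ n)] {ν : Measure Ω'} [IsProbabilityMeasure ν]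
    {X : ∀ n, Ω n → ℝ} {Y : Ω' → ℝ} {T : ℝ} (h : TendstoBeyond T μ ν X Y) (hY : Measurable Y)
    {η : ℝ≥0∞} (hη : 0 < η) :
    ∃ K : ℝ, 0 ≤ K ∧ ν {ω | K < Y ω} ≤ η ∧ ∀ᶠ n in atTop, μ n {ω | K < X n ω} ≤ η := by
  obtain ⟨a, ha0, haη⟩ : ∃ a : ℝ, 0 < a ∧ ENNReal.ofReal a ≤ η := by
    rcases eq_or_ne η ∞ with rfl | htop
    · exact ⟨1, one_pos, le_top⟩
    · exact ⟨η.toReal, ENNReal.toReal_pos hη.ne' htop, ENNReal.ofReal_toReal_le⟩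
  have hle : ∀ x : ℝ≥0∞, x ≠ ∞ → x.toReal < a → x ≤ η := fun x hx hs => by
    rw [← ENNReal.ofReal_toReal hx]
    exact (ENNReal.ofReal_le_ofReal hs.le).trans haη
  have hmono : Monotone fun s : ℝ => ν.real {ω | Y ω ≤ s} := fun s t hst =>
    measureReal_mono fun ω hω => le_trans hω hst
  have htend : Tendsto (fun m : ℕ => ν {ω | (m : ℝ) < Y ω}) atTop (𝓝 0) := by
    have h := tendsto_measure_iInter_atTop (μ := ν) (s := fun m : ℕ => {ω | (m : ℝ) < Y ω})
      (fun m => (measurableSet_lt measurable_const hY).nullMeasurableSet)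
      (fun a b hab ω hω => lt_of_le_of_lt (Nat.cast_le.2 hab) (show (b : ℝ) < Y ω from hω)) ⟨0, measure_ne_top _ _⟩
    have he : (⋂ m : ℕ, {ω | (m : ℝ) < Y ω}) = ∅ := by
      refine Set.eq_empty_iff_forall_notMem.2 fun ω hω => ?_
      obtain ⟨m, hm⟩ := exists_nat_ge (Y ω)
      exact absurd (Set.mem_iInter.1 hω m) (not_lt.2 hm)
    rwa [he, measure_empty] at h
  obtain ⟨m, hm⟩ := (htend.eventually (gt_mem_nhds (ENNReal.ofReal_pos.2 ha0))).exists
  -- A monotone function has countably many discontinuities, so a continuity point exists beyond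
  -- both `T` and `m`.
  obtain ⟨K, hKc, hK⟩ := (hmono.countable_not_continuousAt.dense_compl ℝ).inter_open_nonempty
    (Set.Ioi (max T m)) isOpen_Ioi Set.nonempty_Ioi
  rw [Set.mem_Ioi, max_lt_iff] at hKc
  have hcont : ContinuousAt (fun s : ℝ => ν.real {ω | Y ω ≤ s}) K := not_not.1 hK
  have hνK : ν {ω | K < Y ω} < ENNReal.ofReal a :=
    (measure_mono fun ω (hω : K < Y ω) => hKc.2.trans hω).trans_lt hm
  have hνr : ν.real {ω | K < Y ω} < a := by
    rw [measureReal_def]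
    exact (ENNReal.lt_ofReal_iff_toReal_lt (measure_ne_top _ _)).1 hνK
  refine ⟨K, (Nat.cast_nonneg m).trans hKc.2.le, hle _ (measure_ne_top _ _) hνr, ?_⟩
  filter_upwards [(h K hKc.1 hcont).eventually (gt_mem_nhds hνr)] with n hn
  exact hle _ (measure_ne_top _ _) hn

/-! ### The coupling -/

/-- Diagonal choice: `κ n` is the largest `k ≤ n` with `p n k`. -/
theorem exists_tendsto_atTop_of_eventually {p : ℕ → ℕ → Prop} (h0 : ∀ n, p n 0)
    (h : ∀ k, ∀ᶠ n in atTop, p n k) :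
    ∃ κ : ℕ → ℕ, Tendsto κ atTop atTop ∧ ∀ n, p n (κ n) := by
  classical
  refine ⟨fun n => Nat.findGreatest (p n) n, tendsto_atTop.2 fun k => ?_,
    fun n => Nat.findGreatest_spec (Nat.zero_le n) (h0 n)⟩
  filter_upwards [h k, eventually_ge_atTop k] with n hn hkn using Nat.le_findGreatest hkn hn

/-- If the laws of `g k` under `P n` converge weakly to that under `Q`, for every `k`, then each
`P n` is a `Q`-mixture of discretely labelled probability measures such that the resulting coupling
of `P n` and `Q` brings `g k` close for some `k = κ n → ∞`. -/
theorem exists_mixture_dist_small {E : Type*} [MeasurableSpace E] {F : ℕ → Type*}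
    [∀ k, PseudoMetricSpace (F k)] [∀ k, TopologicalSpace.SeparableSpace (F k)]
    [∀ k, MeasurableSpace (F k)] [∀ k, OpensMeasurableSpace (F k)]
    {g : ∀ k, E → F k} (hg : ∀ k, Measurable (g k))
    (P : ℕ → ProbabilityMeasure E) (Q : ProbabilityMeasure E)
    (h : ∀ k, Tendsto (fun n => (P n).map (hg k).aemeasurable) atTop
      (𝓝 (Q.map (hg k).aemeasurable))) :
    ∃ κ : ℕ → ℕ, Tendsto κ atTop atTop ∧ ∀ n, ∃ (c : E → ℕ) (ν : ℕ → Measure E),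
      Measurable c ∧ (∀ j, IsProbabilityMeasure (ν j)) ∧
      (∀ A, MeasurableSet A → ∫⁻ z, ν (c z) A ∂(Q : Measure E) = (P n : Measure E) A) ∧
      ∫⁻ z, ν (c z) {w | 1 / ((κ n : ℝ) + 1) < dist (g (κ n) w) (g (κ n) z)} ∂(Q : Measure E)
        ≤ 2 * (((κ n + 1 : ℕ) : ℝ≥0∞)⁻¹) := by
  refine exists_tendsto_atTop_of_eventually (p := fun n k => ∃ (c : E → ℕ) (ν : ℕ → Measure E),
      Measurable c ∧ (∀ j, IsProbabilityMeasure (ν j)) ∧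
      (∀ A, MeasurableSet A → ∫⁻ z, ν (c z) A ∂(Q : Measure E) = (P n : Measure E) A) ∧
      ∫⁻ z, ν (c z) {w | 1 / ((k : ℝ) + 1) < dist (g k w) (g k z)} ∂(Q : Measure E)
        ≤ 2 * (((k + 1 : ℕ) : ℝ≥0∞)⁻¹)) (fun n => ?_) fun k => ?_
  -- At `k = 0` the required bound is `2`, so the independent coupling will do.
  · refine ⟨fun _ => 0, fun _ => P n, measurable_const, fun _ => inferInstance,
      fun A _ => by simp, ?_⟩
    calc _ ≤ ∫⁻ _, 1 ∂(Q : Measure E) := lintegral_mono fun z => prob_le_one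
      _ ≤ _ := by simp
  · have hε1 : ((k + 1 : ℕ) : ℝ≥0∞)⁻¹ ≤ 1 := by
      rw [ENNReal.inv_le_one]; exact_mod_cast Nat.le_add_left 1 k
    obtain ⟨m, c, hc, hd, hQ, hev⟩ := exists_label_eventually_le (hg k) P Q (h k)
      (show 0 < 1 / ((k : ℝ) + 1) by positivity) (ε := ((k + 1 : ℕ) : ℝ≥0∞)⁻¹)
      (ENNReal.inv_pos.2 (ENNReal.natCast_ne_top _))
    set ε : ℝ≥0∞ := ((k + 1 : ℕ) : ℝ≥0∞)⁻¹
    filter_upwards [hev] with n hn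
    obtain ⟨ν, hν, hlaw, hcell⟩ := exists_mixture (P n : Measure E) (Q : Measure E) hc
      (t := 1 - ε) tsub_le_self hn
    refine ⟨c, ν, hc, hν, hlaw, ?_⟩
    have hcell' : ∀ᵐ z ∂(Q : Measure E), ν (c z) (c ⁻¹' {c z})ᶜ ≤ ε := by
      have : ∀ᵐ z ∂(Q : Measure E), ∀ j, c z = j → (Q : Measure E) (c ⁻¹' {j}) ≠ 0 := by
        refine ae_all_iff.2 fun j => ?_
        by_cases hj : (Q : Measure E) (c ⁻¹' {j}) = 0
        · filter_upwards [measure_eq_zero_iff_ae_notMem.1 hj] with z hz hzj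
          exact absurd hzj hz
        · exact Eventually.of_forall fun z _ => hj
      filter_upwards [this] with z hz
      exact (hcell _ (hz _ rfl)).trans
        (ENNReal.sub_sub_cancel ENNReal.one_ne_top hε1).le
    calc ∫⁻ z, ν (c z) {w | 1 / ((k : ℝ) + 1) < dist (g k w) (g k z)} ∂(Q : Measure E)
        ≤ ∫⁻ z, ε + (c ⁻¹' {m}).indicator 1 z ∂(Q : Measure E) := by
          refine lintegral_mono_ae ?_
          filter_upwards [hcell'] with z hz
          -- The leftover cell is bounded trivially by `1`; in any other cell, a distant point must
          -- have a different label.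
          by_cases hzm : c z = m
          · have : (c ⁻¹' {m}).indicator (1 : E → ℝ≥0∞) z = 1 :=
              Set.indicator_of_mem (show z ∈ c ⁻¹' {m} from hzm) _
            rw [this]
            exact prob_le_one.trans le_add_self
          · refine (measure_mono fun w hw => ?_).trans (hz.trans le_self_add)
            intro hwz
            exact absurd (hd w z hwz fun hwm => hzm ((show c w = c z from hwz) ▸ hwm))
              (not_le.2 hw)
      _ = ε + (Q : Measure E) (c ⁻¹' {m}) := by
          rw [lintegral_add_left measurable_const, lintegral_const, measure_univ, mul_one,
            lintegral_indicator_one (hc (measurableSet_singleton m))]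
      _ ≤ 2 * ε := by rw [two_mul]; gcongr

/-- Probability measures with the above convergence property can be realised on one probability
space by variables that are close in probability after applying `g (κ n)`, for some `κ n → ∞`. -/
theorem exists_realization_dist_small {E : Type} [MeasurableSpace E] {F : ℕ → Type*}
    [∀ k, PseudoMetricSpace (F k)] [∀ k, SecondCountableTopology (F k)]
    [∀ k, MeasurableSpace (F k)] [∀ k, OpensMeasurableSpace (F k)]
    {g : ∀ k, E → F k} (hg : ∀ k, Measurable (g k))
    (P : ℕ → ProbabilityMeasure E) (Q : ProbabilityMeasure E)
    (h : ∀ k, Tendsto (fun n => (P n).map (hg k).aemeasurable) atTop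
      (𝓝 (Q.map (hg k).aemeasurable))) :
    ∃ (S : Type) (_ : MeasurableSpace S) (R : Measure S) (_ : IsProbabilityMeasure R)
      (X : ℕ → S → E) (Y : S → E) (κ : ℕ → ℕ),
      (∀ n, Measurable (X n)) ∧ Measurable Y ∧ (∀ n, R.map (X n) = P n) ∧ R.map Y = Q ∧
      Tendsto κ atTop atTop ∧
      Tendsto (fun n => R {s | 1 / ((κ n : ℝ) + 1) < dist (g (κ n) (X n s)) (g (κ n) (Y s))})
        atTop (𝓝 0) := by
  obtain ⟨κ, hκ, hmix⟩ := exists_mixture_dist_small hg P Q h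
  choose c ν hc hν hlaw hclose using hmix
  have hν' : ∀ p : ℕ × ℕ, IsProbabilityMeasure (ν p.1 p.2) := fun p => hν p.1 p.2
  have key := fun n => prod_infinitePi_apply (Q : Measure E) (fun p : ℕ × ℕ => ν p.1 p.2) n (hc n)
  refine ⟨E × (ℕ × ℕ → E), inferInstance,
    (Q : Measure E).prod (Measure.infinitePi fun p : ℕ × ℕ => ν p.1 p.2), inferInstance,
    fun n s => s.2 (n, c n s.1), Prod.fst, κ, fun n => (key n).1, measurable_fst, fun n => ?_,
    ?_, hκ, ?_⟩
  · ext A hA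
    rw [Measure.map_apply (key n).1 hA, ← hlaw n A hA]
    exact (key n).2 (Prod.snd ⁻¹' A) (measurable_snd hA)
  · simp
  · have hb : Tendsto (fun n => 2 * (((κ n + 1 : ℕ) : ℝ≥0∞)⁻¹)) atTop (𝓝 0) := by
      have h1 : Tendsto (fun n => ((κ n + 1 : ℕ) : ℝ≥0∞)⁻¹) atTop (𝓝 0) :=
        ENNReal.tendsto_inv_nat_nhds_zero.comp ((tendsto_add_atTop_nat 1).comp hκ)
      simpa using ENNReal.Tendsto.const_mul h1 (Or.inr (ENNReal.ofNat_ne_top (n := 2)))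
    refine tendsto_of_tendsto_of_tendsto_of_le_of_le tendsto_const_nhds hb
      (fun n => zero_le) fun n => ?_
    have hA : MeasurableSet
        {p : E × E | 1 / ((κ n : ℝ) + 1) < dist (g (κ n) p.2) (g (κ n) p.1)} :=
      measurableSet_lt measurable_const
        (((hg _).comp measurable_snd).dist ((hg _).comp measurable_fst))
    exact ((key n).2 _ hA).le.trans (hclose n)

/-! ### The main theorem -/

theorem theorem7 [MeasurableSpace C(I, ℝ)] [BorelSpace C(I, ℝ)]
    {Ω : ℕ → Type*} {Ω' : Type*} [∀ n, MeasurableSpace (Ω n)] [MeasurableSpace Ω']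
    (μ : ∀ n, Measure (Ω n)) [∀ n, IsProbabilityMeasure (μ n)]
    (ν : Measure Ω') [IsProbabilityMeasure ν]
    (W : ∀ n, Ω n → C(I, ℝ)) (hW : ∀ n, Measurable (W n))
    (Z : Ω' → C(I, ℝ)) (hZ : Measurable Z)
    (ρs : ℝ → ℝ) (hρs : IsModulus ρs)
    (hfidi : TendstoFidi μ ν W Z)
    (hWfin : ∀ n, ∀ᵐ ω ∂(μ n), holderSeminorm ρs (W n ω) < ∞)
    (hZfin : ∀ᵐ ω ∂ν, holderSeminorm ρs (Z ω) < ∞)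
    (T : ℝ)
    (hT : TendstoBeyond T μ ν (fun n ω => (holderSeminorm ρs (W n ω)).toReal)
      (fun ω => (holderSeminorm ρs (Z ω)).toReal)) :
    ∃ (S : Type) (_ : MeasurableSpace S) (P : Measure S) (_ : IsProbabilityMeasure P)
      (W' : ℕ → S → C(I, ℝ)) (Z' : S → C(I, ℝ)),
      (∀ n, Measurable (W' n)) ∧ Measurable Z' ∧
      (∀ n, P.map (W' n) = (μ n).map (W n)) ∧ P.map Z' = ν.map Z ∧
      ∀ ρ : ℝ → ℝ, IsModulus ρ → MuchLarger ρ ρs →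
        ∀ ε : ℝ≥0∞, 0 < ε →
          Tendsto (fun n => P {ω | ε < holderSeminorm ρ (W' n ω - Z' ω)}) atTop (𝓝 0) := by
  have hg : ∀ k, Measurable fun (f : C(I, ℝ)) (i : Fin (k + 2)) => f (unitGrid k i) := fun k =>
    (continuous_pi fun i => continuous_eval_const (unitGrid k i)).measurable
  obtain ⟨S, mS, R, hR, X, Y, κ, hX, hY, hXlaw, hYlaw, hκ, hdist⟩ :=
    exists_realization_dist_small hg
      (fun n => ⟨(μ n).map (W n), Measure.isProbabilityMeasure_map (hW n).aemeasurable⟩)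
      ⟨ν.map Z, Measure.isProbabilityMeasure_map hZ.aemeasurable⟩ fun k => by
        have h := (hfidi _ (unitGrid k)).tendsto
        have hPW : ∀ n, ProbabilityMeasure.map ⟨(μ n).map (W n), Measure.isProbabilityMeasure_map
            (hW n).aemeasurable⟩ (hg k).aemeasurable =
            ⟨(μ n).map fun ω i => W n ω (unitGrid k i), Measure.isProbabilityMeasure_map
              ((hg k).comp (hW n)).aemeasurable⟩ :=
          fun n => Subtype.ext (Measure.map_map (hg k) (hW n))
        have hQZ : ProbabilityMeasure.map ⟨ν.map Z, Measure.isProbabilityMeasure_map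
            hZ.aemeasurable⟩ (hg k).aemeasurable =
            ⟨ν.map fun ω i => Z ω (unitGrid k i), Measure.isProbabilityMeasure_map
              ((hg k).comp hZ).aemeasurable⟩ :=
          Subtype.ext (Measure.map_map (hg k) hZ)
        simp only [hPW, hQZ]
        exact h
  refine ⟨S, mS, R, hR, X, Y, hX, hY, hXlaw, hYlaw, fun ρ hρ hρρs ε hε => ?_⟩
  have hmeas : Measurable (holderSeminorm ρs) :=
    measurable_of_Ioi fun K => (isOpen_lt_holderSeminorm ρs K).measurableSet
  have hlevel : ∀ K, MeasurableSet {f : C(I, ℝ) | K < holderSeminorm ρs f} := fun K =>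
    (isOpen_lt_holderSeminorm ρs K).measurableSet
  obtain ⟨a, ha0, haε⟩ : ∃ a : ℝ, 0 < a ∧ ENNReal.ofReal a ≤ ε := by
    rcases eq_or_ne ε ∞ with rfl | htop
    · exact ⟨1, one_pos, le_top⟩
    · exact ⟨ε.toReal, ENNReal.toReal_pos hε.ne' htop, ENNReal.ofReal_toReal_le⟩
  refine ENNReal.tendsto_nhds_zero.2 fun η hη => ?_
  have hη3 : 0 < η / 3 := ENNReal.div_pos hη.ne' (by simp)
  obtain ⟨K, hK, hZK, hWK⟩ := hT.exists_eventually_measure_lt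
    (hmeas.comp hZ).ennreal_toReal hη3
  have hYK : R {s | ENNReal.ofReal K < holderSeminorm ρs (Y s)} ≤ η / 3 := by
    have h := congrArg (fun m => m {f : C(I, ℝ) | ENNReal.ofReal K < holderSeminorm ρs f}) hYlaw
    simp only [ProbabilityMeasure.coe_mk, Measure.map_apply hY (hlevel _),
      Measure.map_apply hZ (hlevel _)] at h
    refine h.le.trans ((measure_mono_ae ?_).trans hZK)
    -- Finiteness matters here because `toReal` sends `∞` to `0`.
    filter_upwards [hZfin] with ω hω h
    exact (ENNReal.ofReal_lt_iff_lt_toReal hK hω.ne).1 h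
  filter_upwards [hWK, hκ.eventually (eventually_holderSeminorm_le_of_unitGrid hρ hρs hρρs
    (show 0 ≤ 2 * K by positivity) ha0), ENNReal.tendsto_nhds_zero.1 hdist _ hη3]
    with n hn hsmall hdn
  have hXK : R {s | ENNReal.ofReal K < holderSeminorm ρs (X n s)} ≤ η / 3 := by
    have h := congrArg (fun m => m {f : C(I, ℝ) | ENNReal.ofReal K < holderSeminorm ρs f})
      (hXlaw n)
    simp only [ProbabilityMeasure.coe_mk, Measure.map_apply (hX n) (hlevel _),
      Measure.map_apply (hW n) (hlevel _)] at h
    refine h.le.trans ((measure_mono_ae ?_).trans hn)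
    filter_upwards [hWfin n] with ω hω h
    exact (ENNReal.ofReal_lt_iff_lt_toReal hK hω.ne).1 h
  have hsub : {s | ε < holderSeminorm ρ (X n s - Y s)} ⊆
      {s | ENNReal.ofReal K < holderSeminorm ρs (X n s)} ∪
      {s | ENNReal.ofReal K < holderSeminorm ρs (Y s)} ∪
      {s | 1 / ((κ n : ℝ) + 1) < dist (fun i => X n s (unitGrid (κ n) i))
        (fun i => Y s (unitGrid (κ n) i))} := by
    intro s hs
    by_contra hcon
    simp only [Set.mem_union, Set.mem_ofPred_eq, not_or, not_lt] at hcon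
    obtain ⟨⟨h1, h2⟩, h3⟩ := hcon
    refine absurd (hsmall _ (holderSeminorm_sub_le hρs hK h1 h2) fun i => ?_)
      (not_le.2 (haε.trans_lt hs))
    exact (dist_le_pi_dist (fun i => X n s (unitGrid (κ n) i))
      (fun i => Y s (unitGrid (κ n) i)) i).trans h3
  calc R {s | ε < holderSeminorm ρ (X n s - Y s)} ≤ η / 3 + η / 3 + η / 3 :=
        (measure_mono hsub).trans ((measure_union_le _ _).trans
          (add_le_add ((measure_union_le _ _).trans (add_le_add hXK hYK)) hdn))
    _ = η := ENNReal.add_thirds η
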